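/- All varieties are over $\mathbb{C}$ and carry the Zariski topology. Let $X\subset\mathbb{P}^3$ be an irreducible closed algebraic curve, let $M_1,M_2$ be $3\times4$ matrices of rank $3$, regarded as projections $\mathbb{P}^3\dashrightarrow\mathbb{P}^2$ whose centers do not lie on $X$, and suppose that $Y_i=M_i(X)\subset\mathbb{P}^2$ is an irreducible plane curve ($i=1,2$). Let $Y_i^\star$ be the dual curve of $Y_i$, i.e. the closure of the set of tangent lines at smooth points of $Y_i$, and suppose that $Y_1^\star$ and $Y_2^\star$ are curves of the same degree $m$ (the common class of $Y_1$ and $Y_2$; this is the case for generic centers of projection), defined by irreducible forms $\phi_1,\phi_2$ of degree $m$. For $(e_1,F,e_2)\in\mathbb{P}^2\times\mathbb{P}^8\times\mathbb{P}^2$, where points of $\mathbb{P}^8$ are regarded as nonzero $3\times3$ matrices up to scalars, consider the generalized Kruppa equation $$\phi_2(Fp)=\lambda\,\phi_1(e_1\times p)\qquad\text{(identically in } p\in\mathbb{C}^3),$$ and let $\{E_i(F,e_1)\}_i$ be the bihomogeneous equations obtained from it by eliminating $\lambda$, namely the vanishing of all $2\times2$ minors of the two-row matrix whose rows are the coefficient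 vectors of the polynomials $\phi_2(Fp)$ and $\phi_1(e_1\times p)$ in $p$. Let $V\subset\mathbb{P}^2\times\mathbb{P}^8\times\mathbb{P}^2$ be the variety defined by the equations $E_i(F,e_1)$ together with $Fe_1=0$ and $e_2^TF=0$. If $V$ is nonempty, then $\dim V\ge 7-m$. Likewise, if the set $V^\circ\subset V$ of those triples for which the Kruppa equation holds with some nonzero scalar $\lambda$ is nonempty, then $\dim V^\circ\ge 7-m$. -/

import Mathlib

open MvPolynomial

namespace Kruppa

/-- The projective space `ℙ(ℂ^ι)` of lines of `ℂ^ι`, carrying the Zariski topology. -/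
def PSpace (ι : Type) : Type := Projectivization ℂ (ι → ℂ)

/-- The projective plane `ℙ²`. -/
abbrev P2 : Type := PSpace (Fin 3)

/-- Projective space `ℙ³`. -/
abbrev P3 : Type := PSpace (Fin 4)

/-- The projective space `ℙ⁸` of `3 × 3` matrices modulo scalars. -/
abbrev P8 : Type := PSpace (Fin 3 × Fin 3)

/-- A vector of homogeneous coordinates of a point. -/
noncomputable def PSpace.coords {ι : Type} (P : PSpace ι) : ι → ℂ := Projectivization.rep P

/-- The point with homogeneous coordinates `v ≠ 0`. -/
noncomputable def PSpace.mk {ι : Type} (v : ι → ℂ) (hv : v ≠ 0) : PSpace ι := Projectivization.mk ℂ v hv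

/-- The matrix (well defined up to a non-zero scalar) represented by a point of `ℙ⁸`. -/
noncomputable def P8.matrix (F : P8) : Matrix (Fin 3) (Fin 3) ℂ :=
  Matrix.of fun i j => F.coords (i, j)

/-- The Zariski topology of a projective space: the sets `{g ≠ 0}`, for `g` homogeneous, are a
basis of open sets, so the closed sets are the zero loci of families of homogeneous polynomials. -/
instance PSpace.zariski (ι : Type) : TopologicalSpace (PSpace ι) :=
  TopologicalSpace.generateFrom
    {U | ∃ (g : MvPolynomial ι ℂ) (k : ℕ), g.IsHomogeneous k ∧ U = {P | eval P.coords g ≠ 0}}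

/-- The product `ℙ² × ℙ⁸ × ℙ²`, the space of triples `(e₁, F, e₂)`. -/
structure Triple : Type where
  /-- the first epipole -/
  e₁ : P2
  /-- the fundamental matrix -/
  F : P8
  /-- the second epipole -/
  e₂ : P2

/-- The coordinate ring of `ℙ² × ℙ⁸ × ℙ²` has one variable for each coordinate of each factor. -/
abbrev TripleVar : Type := Fin 3 ⊕ (Fin 3 × Fin 3) ⊕ Fin 3

/-- The multidegree of each variable. -/
def TripleVar.weight : TripleVar → ℕ × ℕ × ℕ
  | Sum.inl _ => (1, 0, 0)
  | Sum.inr (Sum.inl _) => (0, 1, 0)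
  | Sum.inr (Sum.inr _) => (0, 0, 1)

/-- Multihomogeneous coordinates of a triple. -/
noncomputable def Triple.coords (t : Triple) : TripleVar → ℂ :=
  Sum.elim t.e₁.coords (Sum.elim t.F.coords t.e₂.coords)

/-- The Zariski topology of the projective variety `ℙ² × ℙ⁸ × ℙ²`: the sets `{g ≠ 0}`, for `g`
multihomogeneous, are a basis of open sets. -/
instance Triple.zariski : TopologicalSpace Triple :=
  TopologicalSpace.generateFrom
    {U | ∃ (g : MvPolynomial TripleVar ℂ) (k : ℕ × ℕ × ℕ),
      IsWeightedHomogeneous TripleVar.weight g k ∧ U = {t | eval t.coords g ≠ 0}}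

/-- `X ⊆ ℙ³` is an irreducible closed algebraic curve. -/
def IsSpaceCurve (X : Set P3) : Prop :=
  IsClosed X ∧ IsIrreducible X ∧ topologicalKrullDim X = 1

/-- The image of `X ⊆ ℙ³` under the projection `P ↦ M P` (undefined at the centre, the kernel
of `M`). -/
def projection (M : Matrix (Fin 3) (Fin 4) ℂ) (X : Set P3) : Set P2 :=
  {Q | ∃ P ∈ X, ∃ h : M.mulVec P.coords ≠ 0, Q = PSpace.mk (M.mulVec P.coords) h}

/-- `f` is a form of degree `k` defining the irreducible plane curve `C`: an irreducible form
whose zero locus is `C`. -/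
def IsEquation (f : MvPolynomial (Fin 3) ℂ) (k : ℕ) (C : Set P2) : Prop :=
  f.IsHomogeneous k ∧ Irreducible f ∧ C = {P | eval P.coords f = 0}

/-- The gradient of `f` at `v`. At a smooth point of the curve `f = 0` it is the vector of
coordinates of the tangent line. -/
noncomputable def grad (f : MvPolynomial (Fin 3) ℂ) (v : Fin 3 → ℂ) : Fin 3 → ℂ :=
  fun i => eval v (pderiv i f)

/-- The dual of the plane curve `f = 0` (`f` an irreducible form): the Zariski closure, in the dual
plane, of the set of the tangent lines at the smooth points of the curve. -/
def dualCurve (f : MvPolynomial (Fin 3) ℂ) : Set P2 :=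
  closure {L | ∃ P : P2, eval P.coords f = 0 ∧
    ∃ h : grad f P.coords ≠ 0, L = PSpace.mk (grad f P.coords) h}

/-- The polynomial `φ(F p)` in the coordinates of `p`. -/
noncomputable def compXi (φ : MvPolynomial (Fin 3) ℂ) (F : Matrix (Fin 3) (Fin 3) ℂ) :
    MvPolynomial (Fin 3) ℂ :=
  bind₁ (fun i => ∑ j, C (F i j) * X j) φ

/-- The polynomial `φ(e × p)` in the coordinates of `p`; the cross product `e × p` is the vector
of coordinates of the line joining `e` and `p`. -/
noncomputable def compGamma (φ : MvPolynomial (Fin 3) ℂ) (e : Fin 3 → ℂ) :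
    MvPolynomial (Fin 3) ℂ :=
  bind₁ (crossProduct (fun i => C (e i)) (fun i => X i)) φ

/-- `F e₁ = 0` and `e₂ᵀ F = 0`. -/
def IsEpipolar (t : Triple) : Prop :=
  t.F.matrix.mulVec t.e₁.coords = 0 ∧ Matrix.vecMul t.e₂.coords t.F.matrix = 0

/-- The equations on `(e₁, F)` obtained from `φ₂(F p) = λ φ₁(e₁ × p)` (an identity of polynomials
in `p`) by eliminating the scalar `λ`: the two vectors of coefficients are proportional, i.e. the
`2 × 2` minors of the two-row matrix that they form vanish. -/
def KruppaEquations (φ₁ φ₂ : MvPolynomial (Fin 3) ℂ) (t : Triple) : Prop :=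
  ∀ α β : Fin 3 →₀ ℕ,
    coeff α (compXi φ₂ t.F.matrix) * coeff β (compGamma φ₁ t.e₁.coords) =
      coeff β (compXi φ₂ t.F.matrix) * coeff α (compGamma φ₁ t.e₁.coords)

/-- The variety `V ⊆ ℙ² × ℙ⁸ × ℙ²`. -/
def kruppaVariety (φ₁ φ₂ : MvPolynomial (Fin 3) ℂ) : Set Triple :=
  {t | KruppaEquations φ₁ φ₂ t ∧ IsEpipolar t}

/-- The part of `V` where the Kruppa equation holds with a non-zero scalar `λ`. -/
def kruppaSolutions (φ₁ φ₂ : MvPolynomial (Fin 3) ℂ) : Set Triple :=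
  {t | (∃ c : ℂ, c ≠ 0 ∧ compXi φ₂ t.F.matrix = C c * compGamma φ₁ t.e₁.coords) ∧ IsEpipolar t}

end Kruppa

/-! The bound is a count of equations in a 12-dimensional space. The system `F e₁ = 0`, `e₂ᵀ F = 0`
costs 5 equations instead of 6, because `e₂ᵀ F e₁ = 0` already follows from `F e₁ = 0`. Given `F e₁
= 0`, both `φ₂(F p)` and `φ₁(e₁ × p)` are unchanged when a multiple of `e₁` is added to `p`, so they
are binary forms of degree `m` on the pencil of lines through `e₁`, determined by their values at `m
+ 1` points (`eq_zero_of_eval_linePoint`). Where `φ₁(e₁ × p)` is nonzero at one of these points,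
proportionality amounts to `m` equations, with that value as pivot. Krull's height theorem then
gives dimension at least `12 - (5 + m)` (`le_topologicalKrullDim_add_encard`,
`seven_le_topologicalKrullDim_add`).

The count needs one solution with `φ₁(e₁ × p)` not identically zero. If it is identically zero, the
irreducible form `φ₁` vanishes on a line, hence is linear and `m = 1`; a suitable solution is then
written down with a rank-one `F` (`exists_solution_of_isHomogeneous_one`). -/

namespace Kruppa

/-! ### Krull's height theorem and the height of a point of affine space -/

/-- A form of Krull's height theorem: below a prime ideal `p` containing `s` there is a chain of
primes containing `s` of length at least `height p - |s|`. -/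
theorem height_le_krullDim_add_encard {R : Type*} [CommRing R] [IsNoetherianRing R]
    (s : Set R) (p : PrimeSpectrum R) (hs : s ⊆ p.asIdeal) :
    (p.asIdeal.height : WithBot ℕ∞) ≤
      Order.krullDim {q : PrimeSpectrum R // s ⊆ q.asIdeal ∧ q ≤ p} + (s.encard : ℕ∞) := by
  have h := Ideal.height_le_height_add_encard_of_subset s hs
  have hle : Ideal.span s ≤ p.asIdeal := Ideal.span_le.2 hs
  have hprime := Ideal.isPrime_map_quotientMk_of_isPrime hle
  let p' : PrimeSpectrum (R ⧸ Ideal.span s) := ⟨_, hprime⟩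
  have hp' : (p'.asIdeal.height : WithBot ℕ∞) = Order.krullDim (Set.Iic p') := by
    rw [← Order.height_eq_krullDim_Iic, PrimeSpectrum.height_eq_orderHeight]
  have hcomap : Ideal.comap (Ideal.Quotient.mk (Ideal.span s)) p'.asIdeal = p.asIdeal := by
    change Ideal.comap _ (Ideal.map _ _) = _
    rw [Ideal.comap_map_of_surjective _ Ideal.Quotient.mk_surjective]
    simpa [← RingHom.ker_eq_comap_bot] using hle
  -- Chains below `p'` in the quotient by `s` pull back to chains of primes containing `s`.
  have hk : Order.krullDim (Set.Iic p') ≤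
      Order.krullDim {q : PrimeSpectrum R // s ⊆ q.asIdeal ∧ q ≤ p} := by
    refine Order.krullDim_le_of_strictMono
      (fun q => ⟨PrimeSpectrum.comap (Ideal.Quotient.mk (Ideal.span s)) q.1, ?_, ?_⟩) ?_
    · intro x hx
      change Ideal.Quotient.mk (Ideal.span s) x ∈ q.1.asIdeal
      rw [Ideal.Quotient.eq_zero_iff_mem.2 (Ideal.subset_span hx)]
      exact zero_mem _
    · exact (Ideal.comap_mono (show q.1.asIdeal ≤ p'.asIdeal from q.2)).trans hcomap.le
    · intro q₁ q₂ hq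
      refine lt_of_le_of_ne (Ideal.comap_mono hq.le) fun heq => hq.ne ?_
      apply Subtype.ext
      exact PrimeSpectrum.comap_injective_of_surjective _ Ideal.Quotient.mk_surjective
        (Subtype.ext_iff.1 heq)
  calc (p.asIdeal.height : WithBot ℕ∞) ≤ ((p'.asIdeal.height + s.encard : ℕ∞) : WithBot ℕ∞) := by
        exact_mod_cast h
    _ = (p'.asIdeal.height : WithBot ℕ∞) + (s.encard : ℕ∞) := by push_cast; rfl
    _ ≤ _ := by rw [hp']; gcongr

/-- The translation by `b`, as an automorphism of the polynomial ring. -/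
noncomputable def translation {σ : Type*} (b : σ → ℂ) : MvPolynomial σ ℂ ≃+* MvPolynomial σ ℂ :=
  (AlgEquiv.ofAlgHom (aeval fun i => X i + C (b i)) (aeval fun i => X i - C (b i))
    (by ext; simp) (by ext; simp)).toRingEquiv

theorem eval_translation {σ : Type*} (a b : σ → ℂ) (f : MvPolynomial σ ℂ) :
    eval a (translation b f) = eval (a + b) f := by
  change eval a (aeval _ f) = _
  rw [← MvPolynomial.coe_aeval_eq_eval, RingHom.coe_coe, ← AlgHom.comp_apply,
    ← MvPolynomial.coe_aeval_eq_eval, RingHom.coe_coe]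
  congr 1
  ext; simp

/-- Some maximal ideal attains the dimension of the ring. By the Nullstellensatz it is the ideal of
a point `b`, and a translation carries it to the ideal of `a`. -/
theorem height_vanishingIdeal_singleton {σ : Type*} [Finite σ] (a : σ → ℂ) :
    (vanishingIdeal ℂ {a} : Ideal (MvPolynomial σ ℂ)).height = Nat.card σ := by
  have hdim : ringKrullDim (MvPolynomial σ ℂ) = Nat.card σ := by simp
  have : FiniteRingKrullDim (MvPolynomial σ ℂ) := by
    rw [finiteRingKrullDim_iff_ne_bot_and_top, hdim]
    exact ⟨WithBot.coe_ne_bot, (WithBot.coe_lt_coe.2 (ENat.natCast_lt_top (Nat.card σ))).ne⟩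
  obtain ⟨p, hp, hh⟩ := Ideal.exists_isMaximal_height (R := MvPolynomial σ ℂ)
  obtain ⟨b, rfl⟩ := isMaximal_iff_eq_vanishingIdeal_singleton.1 hp
  rw [hdim] at hh
  have key : (vanishingIdeal ℂ {a} : Ideal (MvPolynomial σ ℂ)) =
      Ideal.comap (translation (b - a)).symm (vanishingIdeal ℂ {b}) := by
    ext f
    rw [Ideal.mem_comap, mem_vanishingIdeal_singleton_iff, mem_vanishingIdeal_singleton_iff]
    change eval a f = 0 ↔ eval b _ = 0
    have := eval_translation a (b - a) ((translation (b - a)).symm f)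
    simp only [RingEquiv.apply_symm_apply, add_sub_cancel] at this
    rw [this]
  rw [key, RingEquiv.height_comap]
  exact_mod_cast hh

/-! ### Multihomogeneous coordinates and the Zariski topology on triples -/

/-- A character of the grading monoid scales every monomial of weighted degree `k` by the same
factor. This serves both the multigrading of triples and ordinary forms. -/
theorem eval_mul_of_isWeightedHomogeneous {M σ : Type*} [AddCommMonoid M] {w : σ → M}
    (χ : Multiplicative M →* ℂ) (v : σ → ℂ) {g : MvPolynomial σ ℂ} {k : M}
    (hg : IsWeightedHomogeneous w g k) :
    eval (fun s => χ (.ofAdd (w s)) * v s) g = χ (.ofAdd k) * eval v g := by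
  rw [eval_eq, eval_eq, Finset.mul_sum]
  refine Finset.sum_congr rfl fun d hd => ?_
  have hd : Finsupp.weight w d = k := hg (mem_support_iff.1 hd)
  rw [← hd, Finsupp.weight_apply, Finsupp.sum, ofAdd_sum, map_prod]
  simp only [mul_pow, Finset.prod_mul_distrib, ofAdd_nsmul, map_pow]
  ring

/-- The character of the grading group attached to a scalar for each of the three factors. -/
noncomputable def scaling (c : ℂ × ℂ × ℂ) : Multiplicative (ℕ × ℕ × ℕ) →* ℂ where
  toFun k := c.1 ^ k.toAdd.1 * (c.2.1 ^ k.toAdd.2.1 * c.2.2 ^ k.toAdd.2.2)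
  map_one' := by simp
  map_mul' a b := by simp [pow_add]; ring

theorem PSpace.exists_coords_mk {ι : Type} (v : ι → ℂ) (hv : v ≠ 0) :
    ∃ c : ℂ, c ≠ 0 ∧ ∀ i, (PSpace.mk v hv).coords i = c * v i := by
  obtain ⟨c, hc⟩ := Projectivization.exists_smul_eq_mk_rep ℂ v hv
  refine ⟨c, c.ne_zero, fun i => ?_⟩
  change (Projectivization.mk ℂ v hv).rep i = _
  rw [← hc]; rfl

theorem PSpace.coords_ne_zero {ι : Type} (P : PSpace ι) : P.coords ≠ 0 :=
  Projectivization.rep_nonzero P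

theorem PSpace.mk_eq {ι : Type} (P : PSpace ι) (v : ι → ℂ) (hv : v ≠ 0) (c : ℂ)
    (h : ∀ i, c * P.coords i = v i) : PSpace.mk v hv = P := by
  have h' := Projectivization.mk_rep P
  rw [← h']
  refine (Projectivization.mk_eq_mk_iff' ℂ _ _ _ _).2 ⟨c, ?_⟩
  ext i
  exact h i

/-- Three vectors `v` are homogeneous coordinates of the triple `t`. -/
def IsCoords (t : Triple) (v : TripleVar → ℂ) : Prop :=
  ∃ c₁ c₂ c₃ : ℂ, c₁ ≠ 0 ∧ c₂ ≠ 0 ∧ c₃ ≠ 0 ∧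
    (∀ i, t.e₁.coords i = c₁ * v (Sum.inl i)) ∧
    (∀ i, t.F.coords i = c₂ * v (Sum.inr (Sum.inl i))) ∧
    ∀ i, t.e₂.coords i = c₃ * v (Sum.inr (Sum.inr i))

theorem IsCoords.eval_eq_zero_iff {t : Triple} {v : TripleVar → ℂ} (h : IsCoords t v)
    {g : MvPolynomial TripleVar ℂ} {k : ℕ × ℕ × ℕ}
    (hg : IsWeightedHomogeneous TripleVar.weight g k) :
    eval t.coords g = 0 ↔ eval v g = 0 := by
  obtain ⟨c₁, c₂, c₃, h₁, h₂, h₃, e₁, e₂, e₃⟩ := h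
  have : t.coords = fun s => scaling (c₁, c₂, c₃) (.ofAdd (TripleVar.weight s)) * v s := by
    ext s
    rcases s with s | s | s <;> simp [Triple.coords, scaling, TripleVar.weight, e₁, e₂, e₃]
  rw [this, eval_mul_of_isWeightedHomogeneous _ _ hg]
  simp [scaling, h₁, h₂, h₃]

theorem isClosed_zeroLocus {g : MvPolynomial TripleVar ℂ} {k : ℕ × ℕ × ℕ}
    (hg : IsWeightedHomogeneous TripleVar.weight g k) :
    IsClosed {t : Triple | eval t.coords g = 0} :=
  ⟨TopologicalSpace.isOpen_generateFrom_of_mem ⟨g, k, hg, rfl⟩⟩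

/-- Products of multihomogeneous polynomials are multihomogeneous, so the generating open sets are
stable under intersection and, with the whole space, form a basis. -/
theorem exists_basic_of_isOpen {U : Set Triple} (hU : IsOpen U) {t : Triple} (ht : t ∈ U) :
    ∃ (g : MvPolynomial TripleVar ℂ) (k : ℕ × ℕ × ℕ),
      IsWeightedHomogeneous TripleVar.weight g k ∧ eval t.coords g ≠ 0 ∧
        ∀ t' : Triple, eval t'.coords g ≠ 0 → t' ∈ U := by
  have hb := TopologicalSpace.isTopologicalBasis_of_subbasis_of_inter
    (rfl : Triple.zariski = TopologicalSpace.generateFrom _) (by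
      rintro _ ⟨g, k, hg, rfl⟩ _ ⟨g', k', hg', rfl⟩
      refine ⟨g * g', k + k', hg.mul hg', ?_⟩
      ext t
      simp)
  obtain ⟨B, hB, htB, hBU⟩ := hb.exists_subset_of_mem_open ht hU
  rcases hB with rfl | ⟨g, k, hg, rfl⟩
  · exact ⟨1, 0, isWeightedHomogeneous_one _ _, by simp, fun t' _ => hBU trivial⟩
  · exact ⟨g, k, hg, htB, fun t' h => hBU h⟩

theorem isPreirreducible_of_forall_eval_mul (V S : Set Triple)
    (h : ∀ (g g' : MvPolynomial TripleVar ℂ) (k k' : ℕ × ℕ × ℕ),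
      IsWeightedHomogeneous TripleVar.weight g k → IsWeightedHomogeneous TripleVar.weight g' k' →
      (∃ t ∈ S ∩ V, eval t.coords g ≠ 0) → (∃ t ∈ S ∩ V, eval t.coords g' ≠ 0) →
      ∃ t ∈ S ∩ V, eval t.coords g ≠ 0 ∧ eval t.coords g' ≠ 0) :
    IsPreirreducible ((↑) ⁻¹' S : Set V) := by
  rintro _ _ ⟨U, hU, rfl⟩ ⟨U', hU', rfl⟩ ⟨t, ht, htU⟩ ⟨t', ht', htU'⟩
  obtain ⟨g, k, hg, hgt, hgU⟩ := exists_basic_of_isOpen hU htU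
  obtain ⟨g', k', hg', hgt', hgU'⟩ := exists_basic_of_isOpen hU' htU'
  obtain ⟨s, ⟨hs, hsV⟩, h₁, h₂⟩ :=
    h g g' k k' hg hg' ⟨t, ⟨ht, t.2⟩, hgt⟩ ⟨t', ⟨ht', t'.2⟩, hgt'⟩
  exact ⟨⟨s, hsV⟩, hs, hgU s h₁, hgU' s h₂⟩

/-! ### Affine charts and homogenization -/

/-- The coordinates of the affine chart of `ℙ² × ℙ⁸ × ℙ²` in which the coordinates numbered
`i`, `k` and `j` of the three factors are `1`. -/
abbrev ChartVar (i : Fin 3) (k : Fin 3 × Fin 3) (j : Fin 3) : Type :=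
  {s : TripleVar // s ≠ Sum.inl i ∧ s ≠ Sum.inr (Sum.inl k) ∧ s ≠ Sum.inr (Sum.inr j)}

theorem card_chartVar (i : Fin 3) (k : Fin 3 × Fin 3) (j : Fin 3) :
    Nat.card (ChartVar i k j) = 12 := by
  rw [Nat.card_eq_fintype_card]
  revert i k j
  decide

section Chart

variable {i : Fin 3} {k : Fin 3 × Fin 3} {j : Fin 3}

/-- The multihomogeneous coordinates as functions of the coordinates of the chart. -/
noncomputable def chartPoly (s : TripleVar) : MvPolynomial (ChartVar i k j) ℂ :=
  if h : s ≠ Sum.inl i ∧ s ≠ Sum.inr (Sum.inl k) ∧ s ≠ Sum.inr (Sum.inr j) then X ⟨s, h⟩ else 1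

/-- The multihomogeneous coordinates of the point of the chart with coordinates `x`. -/
noncomputable def chartCoords (x : ChartVar i k j → ℂ) (s : TripleVar) : ℂ :=
  eval x (chartPoly s)

@[simp] theorem chartPoly_inl : chartPoly (Sum.inl i) = (1 : MvPolynomial (ChartVar i k j) ℂ) := by
  simp [chartPoly]

@[simp] theorem chartPoly_inr_inl :
    chartPoly (Sum.inr (Sum.inl k)) = (1 : MvPolynomial (ChartVar i k j) ℂ) := by
  simp [chartPoly]

@[simp] theorem chartPoly_inr_inr :
    chartPoly (Sum.inr (Sum.inr j)) = (1 : MvPolynomial (ChartVar i k j) ℂ) := by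
  simp [chartPoly]

theorem chartPoly_coe (s : ChartVar i k j) : chartPoly s.1 = X s := by
  simp only [chartPoly]
  rw [dif_pos s.2]

/-- The point of the chart with coordinates `x`. -/
noncomputable def chart (x : ChartVar i k j → ℂ) : Triple where
  e₁ := PSpace.mk (fun l => chartCoords x (Sum.inl l)) fun h => by
    simpa [chartCoords] using congrFun h i
  F := PSpace.mk (fun l => chartCoords x (Sum.inr (Sum.inl l))) fun h => by
    simpa [chartCoords] using congrFun h k
  e₂ := PSpace.mk (fun l => chartCoords x (Sum.inr (Sum.inr l))) fun h => by
    simpa [chartCoords] using congrFun h j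

theorem isCoords_chart (x : ChartVar i k j → ℂ) : IsCoords (chart x) (chartCoords x) := by
  obtain ⟨c₁, h₁, e₁⟩ := PSpace.exists_coords_mk (fun l => chartCoords x (Sum.inl l)) fun h => by
    simpa [chartCoords] using congrFun h i
  obtain ⟨c₂, h₂, e₂⟩ := PSpace.exists_coords_mk (fun l => chartCoords x (Sum.inr (Sum.inl l)))
    fun h => by simpa [chartCoords] using congrFun h k
  obtain ⟨c₃, h₃, e₃⟩ := PSpace.exists_coords_mk (fun l => chartCoords x (Sum.inr (Sum.inr l)))
    fun h => by simpa [chartCoords] using congrFun h j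
  exact ⟨c₁, c₂, c₃, h₁, h₂, h₃, e₁, e₂, e₃⟩

theorem exists_chart_eq (t : Triple) (hi : t.e₁.coords i ≠ 0) (hk : t.F.coords k ≠ 0)
    (hj : t.e₂.coords j ≠ 0) : ∃ x : ChartVar i k j → ℂ, chart x = t := by
  let c : TripleVar → ℂ := Sum.elim (fun _ => (t.e₁.coords i)⁻¹)
    (Sum.elim (fun _ => (t.F.coords k)⁻¹) (fun _ => (t.e₂.coords j)⁻¹))
  have key : ∀ s : TripleVar,
      c s * t.coords s = chartCoords (fun s : ChartVar i k j => c s.1 * t.coords s.1) s := by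
    intro s
    by_cases h : s ≠ Sum.inl i ∧ s ≠ Sum.inr (Sum.inl k) ∧ s ≠ Sum.inr (Sum.inr j)
    · simp only [chartCoords]
      rw [show (s : TripleVar) = (⟨s, h⟩ : ChartVar i k j).1 from rfl, chartPoly_coe, eval_X]
    · simp only [not_and_or, not_not] at h
      rcases h with rfl | rfl | rfl <;>
        simp [chartCoords, c, Triple.coords, hi, hk, hj]
  refine ⟨fun s => c s.1 * t.coords s.1, ?_⟩
  obtain ⟨e, F, e'⟩ := t
  simp only [chart, Triple.mk.injEq]
  exact ⟨PSpace.mk_eq _ _ _ _ fun l => key (Sum.inl l),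
    PSpace.mk_eq _ _ _ _ fun l => key (Sum.inr (Sum.inl l)),
    PSpace.mk_eq _ _ _ _ fun l => key (Sum.inr (Sum.inr l))⟩

theorem eval_bind₁ {σ τ : Type*} (x : τ → ℂ) (f : σ → MvPolynomial τ ℂ) (g : MvPolynomial σ ℂ) :
    eval x (bind₁ f g) = eval (fun s => eval x (f s)) g := by
  change eval₂ _ _ _ = _
  rw [← coe_eval₂Hom, eval₂Hom_bind₁]
  rfl

theorem eval_bind₁_chartPoly (x : ChartVar i k j → ℂ) (g : MvPolynomial TripleVar ℂ) :
    eval x (bind₁ chartPoly g) = eval (chartCoords x) g :=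
  eval_bind₁ x chartPoly g

theorem eval_coords_chart_eq_zero_iff (x : ChartVar i k j → ℂ) {g : MvPolynomial TripleVar ℂ}
    {n : ℕ × ℕ × ℕ} (hg : IsWeightedHomogeneous TripleVar.weight g n) :
    eval (chart x).coords g = 0 ↔ eval x (bind₁ chartPoly g) = 0 := by
  rw [(isCoords_chart x).eval_eq_zero_iff hg, eval_bind₁_chartPoly]

/-- Turns a function on the chart into one defining a closed set of triples. Multiplying by the
three coordinates that equal `1` on the chart equalizes degrees, so sums remain multihomogeneous. -/
theorem exists_homogenization (h : MvPolynomial (ChartVar i k j) ℂ) :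
    ∃ (H : MvPolynomial TripleVar ℂ) (n : ℕ),
      IsWeightedHomogeneous TripleVar.weight H (n, n, n) ∧ bind₁ chartPoly H = h := by
  let P : MvPolynomial TripleVar ℂ :=
    X (Sum.inl i) * X (Sum.inr (Sum.inl k)) * X (Sum.inr (Sum.inr j))
  have hP : IsWeightedHomogeneous TripleVar.weight P (1, 1, 1) :=
    ((isWeightedHomogeneous_X ℂ _ _).mul (isWeightedHomogeneous_X ℂ _ _)).mul
      (isWeightedHomogeneous_X ℂ _ _)
  have hP1 : bind₁ (chartPoly (i := i) (k := k) (j := j)) P = 1 := by simp [P]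
  have hPn : ∀ n : ℕ, IsWeightedHomogeneous TripleVar.weight (P ^ n) (n, n, n) := fun n => by
    simpa using hP.pow n
  induction h using MvPolynomial.induction_on with
  | C a => exact ⟨C a, 0, isWeightedHomogeneous_C _ a, by simp⟩
  | add p q hp hq =>
    obtain ⟨H, n, hH, rfl⟩ := hp
    obtain ⟨H', n', hH', rfl⟩ := hq
    refine ⟨H * P ^ n' + H' * P ^ n, n + n', ?_, by simp [hP1]⟩
    refine (hH.mul (hPn n')).add ?_
    have := hH'.mul (hPn n)
    simpa [add_comm n n'] using this
  | mul_X p s hp =>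
    obtain ⟨H, n, hH, rfl⟩ := hp
    obtain ⟨Q, hQ, hQs⟩ : ∃ Q : MvPolynomial TripleVar ℂ,
        IsWeightedHomogeneous TripleVar.weight Q (1, 1, 1) ∧ bind₁ chartPoly Q = X s := by
      rw [← chartPoly_coe s]
      rcases s.1 with l | l | l
      · exact ⟨X (Sum.inl l) * X (Sum.inr (Sum.inl k)) * X (Sum.inr (Sum.inr j)),
          ((isWeightedHomogeneous_X ℂ _ _).mul (isWeightedHomogeneous_X ℂ _ _)).mul
            (isWeightedHomogeneous_X ℂ _ _), by simp⟩
      · exact ⟨X (Sum.inl i) * X (Sum.inr (Sum.inl l)) * X (Sum.inr (Sum.inr j)),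
          ((isWeightedHomogeneous_X ℂ _ _).mul (isWeightedHomogeneous_X ℂ _ _)).mul
            (isWeightedHomogeneous_X ℂ _ _), by simp⟩
      · exact ⟨X (Sum.inl i) * X (Sum.inr (Sum.inl k)) * X (Sum.inr (Sum.inr l)),
          ((isWeightedHomogeneous_X ℂ _ _).mul (isWeightedHomogeneous_X ℂ _ _)).mul
            (isWeightedHomogeneous_X ℂ _ _), by simp⟩
    exact ⟨H * Q, n + 1, hH.mul hQ, by simp [hQs]⟩

/-! ### From chains of primes to dimension -/

theorem exists_eval_ne_zero_of_notMem {σ : Type*} [Finite σ] {q : Ideal (MvPolynomial σ ℂ)}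
    [q.IsPrime] {f : MvPolynomial σ ℂ} (hf : f ∉ q) :
    ∃ x ∈ zeroLocus ℂ q, eval x f ≠ 0 := by
  by_contra! h
  exact hf (IsPrime.vanishingIdeal_zeroLocus (K := ℂ) q ▸
    (mem_vanishingIdeal_iff.2 h : f ∈ vanishingIdeal ℂ (zeroLocus ℂ q)))

/-- If, near a point of a chart, a set `V` of triples contains the common zeros of `n` functions,
its dimension is at least `12 - n`. -/
theorem le_topologicalKrullDim_add_encard (V : Set Triple) (a : ChartVar i k j → ℂ)
    (s : Set (MvPolynomial (ChartVar i k j) ℂ)) (g : MvPolynomial (ChartVar i k j) ℂ)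
    (hs : ∀ f ∈ s, eval a f = 0) (hg : eval a g ≠ 0)
    (hV : ∀ x : ChartVar i k j → ℂ, (∀ f ∈ s, eval x f = 0) → eval x g ≠ 0 → chart x ∈ V) :
    (12 : WithBot ℕ∞) ≤ topologicalKrullDim V + (s.encard : ℕ∞) := by
  let p : PrimeSpectrum (MvPolynomial (ChartVar i k j) ℂ) := ⟨vanishingIdeal ℂ {a}, inferInstance⟩
  have hp : ∀ f, f ∈ p.asIdeal ↔ eval a f = 0 := fun f => mem_vanishingIdeal_singleton_iff _ _
  have h := height_le_krullDim_add_encard s p fun f hf => (hp f).2 (hs f hf)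
  have h12 : (p.asIdeal.height : WithBot ℕ∞) = 12 := by
    rw [height_vanishingIdeal_singleton, card_chartVar]; rfl
  rw [h12] at h
  refine h.trans ?_
  gcongr
  -- The part of the zero locus of `q` where `g ≠ 0`; the hypothesis `hV` places it inside `V`.
  let Z (q : Ideal (MvPolynomial (ChartVar i k j) ℂ)) : Set Triple :=
    chart '' {x | x ∈ zeroLocus ℂ q ∧ eval x g ≠ 0}
  have hZV : ∀ q : PrimeSpectrum (MvPolynomial (ChartVar i k j) ℂ), s ⊆ q.asIdeal →
      Z q.asIdeal ⊆ V := by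
    rintro q hq _ ⟨x, ⟨hx, hxg⟩, rfl⟩
    exact hV x (fun f hf => hx f (hq hf)) hxg
  have hgq : ∀ q : PrimeSpectrum (MvPolynomial (ChartVar i k j) ℂ), q ≤ p → g ∉ q.asIdeal :=
    fun q hq h => hg ((hp g).1 (hq h))
  have hirr : ∀ q : {q : PrimeSpectrum (MvPolynomial (ChartVar i k j) ℂ) //
      s ⊆ q.asIdeal ∧ q ≤ p}, IsIrreducible ((↑) ⁻¹' Z q.1.asIdeal : Set V) := by
    rintro ⟨q, hqs, hqp⟩
    constructor
    · have ha : chart a ∈ Z q.asIdeal := ⟨a, ⟨fun f hf => (hp f).1 (hqp hf), hg⟩, rfl⟩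
      exact ⟨⟨chart a, hZV q hqs ha⟩, ha⟩
    · apply isPreirreducible_of_forall_eval_mul
      rintro G G' n n' hG hG' ⟨_, ⟨⟨x, ⟨hx, hxg⟩, rfl⟩, -⟩, hxG⟩ ⟨_, ⟨⟨x', ⟨hx', hxg'⟩, rfl⟩, -⟩, hxG'⟩
      rw [Ne, eval_coords_chart_eq_zero_iff x hG] at hxG
      rw [Ne, eval_coords_chart_eq_zero_iff x' hG'] at hxG'
      have h1 : bind₁ chartPoly G ∉ q.asIdeal := fun h => hxG (hx _ h)
      have h2 : bind₁ chartPoly G' ∉ q.asIdeal := fun h => hxG' (hx' _ h)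
      -- Irreducibility is primality of `q`: the product, including `g`, stays outside `q`, so one
      -- zero of `q` avoids all three factors.
      have h3 : bind₁ chartPoly G * bind₁ chartPoly G' * g ∉ q.asIdeal := fun h =>
        (q.2.mem_or_mem h).elim (fun h => (q.2.mem_or_mem h).elim h1 h2) (hgq q hqp)
      obtain ⟨y, hy, hyG⟩ := exists_eval_ne_zero_of_notMem h3
      simp only [map_mul, mul_ne_zero_iff] at hyG
      have hyZ : chart y ∈ Z q.asIdeal := ⟨y, ⟨hy, hyG.2⟩, rfl⟩
      refine ⟨chart y, ⟨hyZ, hZV q hqs hyZ⟩, ?_, ?_⟩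
      · rw [Ne, eval_coords_chart_eq_zero_iff y hG]; exact hyG.1.1
      · rw [Ne, eval_coords_chart_eq_zero_iff y hG']; exact hyG.1.2
  let T (q : {q : PrimeSpectrum (MvPolynomial (ChartVar i k j) ℂ) // s ⊆ q.asIdeal ∧ q ≤ p}) :
      TopologicalSpace.IrreducibleCloseds V :=
    ⟨closure ((↑) ⁻¹' Z q.1.asIdeal), (hirr q).closure, isClosed_closure⟩
  -- Larger primes have smaller loci, hence the passage to the order dual.
  suffices hT : ∀ q q', q < q' → T q' < T q by
    rw [topologicalKrullDim, ← Order.krullDim_orderDual]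
    exact Order.krullDim_le_of_strictMono (fun q => T (OrderDual.ofDual q))
      fun q q' hqq' => hT _ _ hqq'
  intro q q' hqq'
  refine lt_of_le_of_ne (closure_mono (Set.preimage_mono (Set.image_mono fun x hx =>
    ⟨fun f hf => hx.1 f (hqq'.le hf), hx.2⟩))) fun heq => ?_
  -- Strictness: the homogenization of some `h` in `q'` but not in `q` vanishes on `T q'`, yet not
  -- at a zero of `q` with `g * h ≠ 0`.
  obtain ⟨h, hhq', hhq⟩ := SetLike.exists_of_lt (show q.1.asIdeal < q'.1.asIdeal from hqq')
  have hgh : g * h ∉ q.1.asIdeal := fun hm => (q.1.2.mem_or_mem hm).elim (hgq _ q.2.2) hhq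
  obtain ⟨y, hy, hyh⟩ := exists_eval_ne_zero_of_notMem hgh
  simp only [map_mul, mul_ne_zero_iff] at hyh
  obtain ⟨H, n, hH, hHh⟩ := exists_homogenization h
  have hyZ : chart y ∈ Z q.1.asIdeal := ⟨y, ⟨hy, hyh.1⟩, rfl⟩
  have hsub : closure ((↑) ⁻¹' Z q'.1.asIdeal : Set V) ⊆ (↑) ⁻¹' {t : Triple | eval t.coords H = 0} := by
    refine closure_minimal (Set.preimage_mono ?_) ((isClosed_zeroLocus hH).preimage
      continuous_subtype_val)
    rintro _ ⟨x, ⟨hx, -⟩, rfl⟩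
    rw [Set.mem_ofPred_eq, eval_coords_chart_eq_zero_iff x hH, hHh]
    exact hx h hhq'
  have heq' : closure ((↑) ⁻¹' Z q'.1.asIdeal : Set V) = closure ((↑) ⁻¹' Z q.1.asIdeal) :=
    congrArg (fun T : TopologicalSpace.IrreducibleCloseds V => (T : Set V)) heq
  have hmem : (⟨chart y, hZV _ q.2.1 hyZ⟩ : V) ∈ closure ((↑) ⁻¹' Z q.1.asIdeal : Set V) :=
    subset_closure hyZ
  rw [← heq'] at hmem
  have := hsub hmem
  rw [Set.mem_preimage, Set.mem_ofPred_eq, eval_coords_chart_eq_zero_iff y hH, hHh] at this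
  exact hyh.2 this

end Chart

/-! ### The two sides of the Kruppa equation as binary forms -/

theorem eval_compXi (φ : MvPolynomial (Fin 3) ℂ) (F : Matrix (Fin 3) (Fin 3) ℂ) (p : Fin 3 → ℂ) :
    eval p (compXi φ F) = eval (F.mulVec p) φ := by
  rw [compXi, eval_bind₁]
  congr 2
  ext i
  simp [Matrix.mulVec, dotProduct]

theorem eval_compGamma (φ : MvPolynomial (Fin 3) ℂ) (e p : Fin 3 → ℂ) :
    eval p (compGamma φ e) = eval (crossProduct e p) φ := by
  rw [compGamma, eval_bind₁]
  congr 2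
  ext i
  fin_cases i <;> simp [cross_apply]

theorem isHomogeneous_compXi {φ : MvPolynomial (Fin 3) ℂ} {m : ℕ} (h : φ.IsHomogeneous m)
    (F : Matrix (Fin 3) (Fin 3) ℂ) : (compXi φ F).IsHomogeneous m := by
  have := h.aeval (fun i => ∑ j, C (F i j) * X j : Fin 3 → MvPolynomial (Fin 3) ℂ) (n := 1)
    fun i => IsHomogeneous.sum _ _ _ fun j _ => isHomogeneous_C_mul_X _ _
  rwa [one_mul] at this

theorem isHomogeneous_compGamma {φ : MvPolynomial (Fin 3) ℂ} {m : ℕ} (h : φ.IsHomogeneous m)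
    (e : Fin 3 → ℂ) : (compGamma φ e).IsHomogeneous m := by
  have := h.aeval (crossProduct (fun i => C (e i)) (fun i => X i) :
    Fin 3 → MvPolynomial (Fin 3) ℂ) (n := 1) fun i => by
      rw [cross_apply]
      fin_cases i <;> exact (isHomogeneous_C_mul_X _ _).sub (isHomogeneous_C_mul_X _ _)
  rwa [one_mul] at this

theorem eval_smul_of_isHomogeneous {σ : Type*} {φ : MvPolynomial σ ℂ} {m : ℕ}
    (h : φ.IsHomogeneous m) (c : ℂ) (v : σ → ℂ) : eval (c • v) φ = c ^ m * eval v φ := by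
  simpa [powersHom_apply, Pi.smul_def] using
    eval_mul_of_isWeightedHomogeneous (w := (1 : σ → ℕ)) (powersHom ℂ c) v h

theorem compXi_smul {φ : MvPolynomial (Fin 3) ℂ} {m : ℕ} (h : φ.IsHomogeneous m) (c : ℂ)
    (F : Matrix (Fin 3) (Fin 3) ℂ) : compXi φ (c • F) = C (c ^ m) * compXi φ F := by
  refine MvPolynomial.funext fun p => ?_
  rw [eval_compXi, Matrix.smul_mulVec, eval_smul_of_isHomogeneous h, map_mul, eval_C, eval_compXi]

theorem compGamma_smul {φ : MvPolynomial (Fin 3) ℂ} {m : ℕ} (h : φ.IsHomogeneous m) (c : ℂ)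
    (e : Fin 3 → ℂ) : compGamma φ (c • e) = C (c ^ m) * compGamma φ e := by
  refine MvPolynomial.funext fun p => ?_
  rw [eval_compGamma, map_smul, LinearMap.smul_apply, eval_smul_of_isHomogeneous h, map_mul,
    eval_C, eval_compGamma]

/-- Points of the line `p i = 0`. -/
noncomputable def linePoint (i : Fin 3) (n : ℕ) : Fin 3 → ℂ :=
  fun a => if a = i then 0 else if a = i + 1 then 1 else n

theorem eq_add_two_of_ne {a i : Fin 3} (h : a ≠ i) (h' : a ≠ i + 1) : a = i + 2 := by
  revert a i
  decide

/-- A form of degree `m` on the plane that comes from a form on the pencil of lines through a point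
`e` is zero if it vanishes at `m + 1` points of a line not through `e`. -/
theorem eq_zero_of_eval_linePoint {f : MvPolynomial (Fin 3) ℂ} {m : ℕ} (hf : f.IsHomogeneous m)
    {e : Fin 3 → ℂ} {i : Fin 3} (he : e i = 1)
    (hinv : ∀ (p : Fin 3 → ℂ) (c : ℂ), eval (p + c • e) f = eval p f)
    (h0 : ∀ n : Fin (m + 1), eval (linePoint i n) f = 0) : f = 0 := by
  have hi : i + 1 ≠ i := by simp
  -- The restriction of `f` to the affine line of points with coordinates `0`, `1`, `w` in cyclic
  -- order from `i`: degree at most `m`, with `m + 1` zeros.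
  let q : Polynomial ℂ := aeval (fun a => if a = i then 0 else if a = i + 1 then 1 else Polynomial.X) f
  have hq : ∀ w : ℂ, q.eval w = eval (fun a => if a = i then 0 else if a = i + 1 then 1 else w) f := by
    intro w
    have : (Polynomial.aeval w).comp (aeval (R := ℂ)
        (fun a => if a = i then 0 else if a = i + 1 then 1 else Polynomial.X)) =
        aeval (fun a => if a = i then 0 else if a = i + 1 then 1 else w) := by
      ext a
      simp only [AlgHom.comp_apply, aeval_X]
      split_ifs <;> simp
    have := DFunLike.congr_fun this f
    simpa [aeval_eq_eval] using this
  have hq0 : q = 0 := by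
    refine Polynomial.eq_zero_of_natDegree_lt_card_of_eval_eq_zero q
      (f := fun n : Fin (m + 1) => ((n : ℕ) : ℂ)) ?_ ?_ ?_
    · intro a b hab
      exact Fin.ext (Nat.cast_injective (R := ℂ) hab)
    · intro n
      rw [hq]
      exact h0 n
    · rw [Fintype.card_fin, Nat.lt_succ_iff]
      refine (aeval_natDegree_le f hf.totalDegree_le _ (n := 1) fun a => ?_).trans (by simp)
      split_ifs <;> simp
  -- Moving `p` along `e` to the line `p i = 0` gives coordinate `u` at `i + 1`. If `u ≠ 0`, the
  -- result is `u` times a point of the affine line; the linear factor absorbs the case `u = 0`.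
  have hL : f * (X (i + 1) - C (e (i + 1)) * X i) = 0 := by
    refine MvPolynomial.funext fun p => ?_
    simp only [map_mul, map_sub, eval_X, eval_C, map_zero, mul_eq_zero]
    by_cases hp : p (i + 1) - e (i + 1) * p i = 0
    · exact Or.inr hp
    left
    rw [← hinv p (-p i)]
    set u := p (i + 1) - e (i + 1) * p i with hu
    have : p + (-p i) • e = u • fun a => if a = i then 0 else if a = i + 1 then 1 else
        (p a - p i * e a) / u := by
      ext a
      simp only [Pi.add_apply, Pi.smul_apply, smul_eq_mul]
      split_ifs with h1 h2
      · subst h1; rw [he]; ring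
      · subst h2; rw [hu]; ring
      · field_simp; ring
    rw [this, eval_smul_of_isHomogeneous hf]
    have h2 : (fun a => if a = i then 0 else if a = i + 1 then 1 else (p a - p i * e a) / u) =
        fun a => if a = i then 0 else if a = i + 1 then (1 : ℂ) else
          (p (i + 2) - p i * e (i + 2)) / u := by
      ext a
      split_ifs with h1 h2
      · rfl
      · rfl
      · rw [eq_add_two_of_ne h1 h2]
    rw [h2, ← hq, hq0]
    simp
  refine (mul_eq_zero.1 hL).resolve_right fun h => ?_
  have := congrArg (eval (Pi.single (i + 1) 1)) h
  simp [hi.symm] at this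

/-! ### Independence of the choice of coordinates -/

/-- The first epipole, in homogeneous coordinates of a triple. -/
def epipole₁ (v : TripleVar → ℂ) : Fin 3 → ℂ := fun l => v (Sum.inl l)

/-- The second epipole, in homogeneous coordinates of a triple. -/
def epipole₂ (v : TripleVar → ℂ) : Fin 3 → ℂ := fun l => v (Sum.inr (Sum.inr l))

/-- The fundamental matrix, in homogeneous coordinates of a triple. -/
def fundamental (v : TripleVar → ℂ) : Matrix (Fin 3) (Fin 3) ℂ :=
  Matrix.of fun a b => v (Sum.inr (Sum.inl (a, b)))

theorem IsCoords.exists_smul {t : Triple} {v : TripleVar → ℂ} (h : IsCoords t v) :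
    ∃ c₁ c₂ c₃ : ℂ, c₁ ≠ 0 ∧ c₂ ≠ 0 ∧ c₃ ≠ 0 ∧ t.e₁.coords = c₁ • epipole₁ v ∧
      t.F.matrix = c₂ • fundamental v ∧ t.e₂.coords = c₃ • epipole₂ v := by
  obtain ⟨c₁, c₂, c₃, h₁, h₂, h₃, e₁, e₂, e₃⟩ := h
  refine ⟨c₁, c₂, c₃, h₁, h₂, h₃, _root_.funext e₁, ?_, _root_.funext e₃⟩
  ext a b
  exact e₂ (a, b)

theorem IsCoords.isEpipolar_iff {t : Triple} {v : TripleVar → ℂ} (h : IsCoords t v) :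
    IsEpipolar t ↔ (fundamental v).mulVec (epipole₁ v) = 0 ∧
      Matrix.vecMul (epipole₂ v) (fundamental v) = 0 := by
  obtain ⟨c₁, c₂, c₃, h₁, h₂, h₃, e₁, e₂, e₃⟩ := h.exists_smul
  rw [IsEpipolar, e₁, e₂, e₃, Matrix.smul_mulVec, Matrix.mulVec_smul, Matrix.smul_vecMul,
    Matrix.vecMul_smul]
  simp [h₁, h₂, h₃]

theorem IsCoords.compGamma_eq_zero_iff {t : Triple} {v : TripleVar → ℂ} (h : IsCoords t v)
    {φ : MvPolynomial (Fin 3) ℂ} {m : ℕ} (hφ : φ.IsHomogeneous m) :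
    compGamma φ t.e₁.coords = 0 ↔ compGamma φ (epipole₁ v) = 0 := by
  obtain ⟨c₁, c₂, c₃, h₁, h₂, h₃, e₁, e₂, e₃⟩ := h.exists_smul
  rw [e₁, compGamma_smul hφ, mul_eq_zero, C_eq_zero]
  simp [h₁]

/-- Both sides have degree `m`, so changing representatives multiplies `λ` by a nonzero factor and
preserves the condition `λ ≠ 0`. -/
theorem IsCoords.exists_ne_zero {t : Triple} {v : TripleVar → ℂ} (h : IsCoords t v) {m : ℕ}
    {φ₁ φ₂ : MvPolynomial (Fin 3) ℂ} (hφ₁ : φ₁.IsHomogeneous m) (hφ₂ : φ₂.IsHomogeneous m) :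
    ∃ r : ℂ, r ≠ 0 ∧ ∀ c : ℂ, compXi φ₂ t.F.matrix = C c * compGamma φ₁ t.e₁.coords ↔
      compXi φ₂ (fundamental v) = C (r * c) * compGamma φ₁ (epipole₁ v) := by
  obtain ⟨c₁, c₂, c₃, h₁, h₂, h₃, e₁, e₂, e₃⟩ := h.exists_smul
  refine ⟨(c₂ ^ m)⁻¹ * c₁ ^ m, by positivity, fun c => ?_⟩
  have hc : (c₂ ^ m) ≠ 0 := pow_ne_zero _ h₂
  rw [e₁, e₂, compGamma_smul hφ₁, compXi_smul hφ₂]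
  rw [show ((c₂ ^ m)⁻¹ * c₁ ^ m * c) = (c₂ ^ m)⁻¹ * (c * c₁ ^ m) by ring, map_mul C, mul_assoc,
    map_mul C, mul_assoc]
  constructor
  · intro h
    rw [← h, ← mul_assoc, ← map_mul, inv_mul_cancel₀ hc, C_1, one_mul]
  · intro h
    rw [h, ← mul_assoc, ← map_mul, mul_inv_cancel₀ hc, C_1, one_mul]

/-! ### The `5 + m` local equations -/

section Equations

variable {i : Fin 3} {k : Fin 3 × Fin 3} {j : Fin 3}

/-- The value `φ(F p)` as a function on a chart. -/
noncomputable def chartXi (φ : MvPolynomial (Fin 3) ℂ) (p : Fin 3 → ℂ) :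
    MvPolynomial (ChartVar i k j) ℂ :=
  bind₁ (fun a => ∑ b, chartPoly (Sum.inr (Sum.inl (a, b))) * C (p b)) φ

/-- The value `φ(e₁ × p)` as a function on a chart. -/
noncomputable def chartGamma (φ : MvPolynomial (Fin 3) ℂ) (p : Fin 3 → ℂ) :
    MvPolynomial (ChartVar i k j) ℂ :=
  bind₁ (crossProduct (fun a => chartPoly (Sum.inl a)) (fun a => C (p a))) φ

theorem eval_chartXi (φ : MvPolynomial (Fin 3) ℂ) (p : Fin 3 → ℂ) (x : ChartVar i k j → ℂ) :
    eval x (chartXi φ p) = eval p (compXi φ (fundamental (chartCoords x))) := by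
  rw [chartXi, eval_bind₁, eval_compXi]
  congr 2
  ext a
  simp [Matrix.mulVec, dotProduct, fundamental, chartCoords]

theorem eval_chartGamma (φ : MvPolynomial (Fin 3) ℂ) (p : Fin 3 → ℂ) (x : ChartVar i k j → ℂ) :
    eval x (chartGamma φ p) = eval p (compGamma φ (epipole₁ (chartCoords x))) := by
  rw [chartGamma, eval_bind₁, eval_compGamma]
  congr 2
  ext a
  fin_cases a <;> simp [cross_apply, epipole₁, chartCoords]

/-- The local equations of the Kruppa variety: `F e₁ = 0`, two coordinates of `e₂ᵀ F = 0` and the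
proportionality of the values of the two forms at `m + 1` points, one of which is numbered `n₀`. -/
noncomputable def localEquation (φ₁ φ₂ : MvPolynomial (Fin 3) ℂ) (m : ℕ) (n₀ : Fin (m + 1)) :
    Fin 3 ⊕ {l : Fin 3 // l ≠ i} ⊕ {n : Fin (m + 1) // n ≠ n₀} → MvPolynomial (ChartVar i k j) ℂ
  | Sum.inl a => ∑ b, chartPoly (Sum.inr (Sum.inl (a, b))) * chartPoly (Sum.inl b)
  | Sum.inr (Sum.inl l) =>
    ∑ a, chartPoly (Sum.inr (Sum.inr a)) * chartPoly (Sum.inr (Sum.inl (a, l.1)))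
  | Sum.inr (Sum.inr n) =>
    chartXi φ₂ (linePoint i n.1) * chartGamma φ₁ (linePoint i n₀) -
      chartXi φ₂ (linePoint i n₀) * chartGamma φ₁ (linePoint i n.1)

theorem eval_compXi_add (φ : MvPolynomial (Fin 3) ℂ) {F : Matrix (Fin 3) (Fin 3) ℂ}
    {e : Fin 3 → ℂ} (he : F.mulVec e = 0) (p : Fin 3 → ℂ) (c : ℂ) :
    eval (p + c • e) (compXi φ F) = eval p (compXi φ F) := by
  rw [eval_compXi, eval_compXi, Matrix.mulVec_add, Matrix.mulVec_smul, he, smul_zero, add_zero]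

theorem eval_compGamma_add (φ : MvPolynomial (Fin 3) ℂ) (e p : Fin 3 → ℂ) (c : ℂ) :
    eval (p + c • e) (compGamma φ e) = eval p (compGamma φ e) := by
  rw [eval_compGamma, eval_compGamma, map_add, map_smul, cross_self, smul_zero, add_zero]

theorem seven_le_add_of_twelve_le {D : WithBot ℕ∞} {m : ℕ}
    (h : 12 ≤ D + ((5 + m : ℕ) : ℕ∞)) : 7 ≤ D + (m : WithBot ℕ∞) := by
  induction D with
  | bot => simp at h
  | coe D =>
    have h' : (12 : ℕ∞) ≤ D + (5 + m : ℕ) := WithBot.coe_le_coe.1 h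
    refine WithBot.coe_le_coe.2 (?_ : (7 : ℕ∞) ≤ D + m)
    induction D with
    | top => simp
    | coe D =>
      have h'' : 12 ≤ D + (5 + m) := by exact_mod_cast h'
      exact_mod_cast (by omega : 7 ≤ D + m)

/-- Near a triple with `φ₁(e₁ × p) ≠ 0` the solutions have dimension at least `7 - m`. -/
theorem seven_le_topologicalKrullDim_add {φ₁ φ₂ : MvPolynomial (Fin 3) ℂ} {m : ℕ}
    (hφ₁ : φ₁.IsHomogeneous m) (hφ₂ : φ₂.IsHomogeneous m) (V : Set Triple) (t₀ : Triple) (c₀ : ℂ)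
    (ht₀ : IsEpipolar t₀) (hγ : compGamma φ₁ t₀.e₁.coords ≠ 0)
    (hc₀ : compXi φ₂ t₀.F.matrix = C c₀ * compGamma φ₁ t₀.e₁.coords)
    (hV : ∀ t, IsEpipolar t → ∀ c : ℂ, (c₀ ≠ 0 → c ≠ 0) →
      compXi φ₂ t.F.matrix = C c * compGamma φ₁ t.e₁.coords → t ∈ V) :
    (7 : WithBot ℕ∞) ≤ topologicalKrullDim V + (m : WithBot ℕ∞) := by
  obtain ⟨i, hi⟩ := Function.ne_iff.1 t₀.e₁.coords_ne_zero
  obtain ⟨k, hk⟩ := Function.ne_iff.1 t₀.F.coords_ne_zero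
  obtain ⟨j, hj⟩ := Function.ne_iff.1 t₀.e₂.coords_ne_zero
  obtain ⟨a, rfl⟩ := exists_chart_eq (i := i) (k := k) (j := j) t₀ hi hk hj
  have hone : ∀ x : ChartVar i k j → ℂ, epipole₁ (chartCoords x) i = 1 := fun x => by
    simp [epipole₁, chartCoords]
  obtain ⟨r, hr, hrc⟩ := (isCoords_chart a).exists_ne_zero hφ₁ hφ₂
  rw [hrc] at hc₀
  rw [Ne, (isCoords_chart a).compGamma_eq_zero_iff hφ₁] at hγ
  rw [(isCoords_chart a).isEpipolar_iff] at ht₀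
  obtain ⟨n₀, hn₀⟩ : ∃ n : Fin (m + 1), eval (linePoint i n)
      (compGamma φ₁ (epipole₁ (chartCoords a))) ≠ 0 := by
    by_contra! h
    exact hγ (eq_zero_of_eval_linePoint (isHomogeneous_compGamma hφ₁ _) (hone a)
      (eval_compGamma_add _ _) h)
  -- Where `g ≠ 0` the pivot survives and, if `c₀ ≠ 0`, so does the other side at `n₀`, which keeps
  -- `λ` nonzero.
  let g : MvPolynomial (ChartVar i k j) ℂ := chartGamma φ₁ (linePoint i n₀) *
    if c₀ = 0 then 1 else chartXi φ₂ (linePoint i n₀)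
  have h12 := le_topologicalKrullDim_add_encard V a (Set.range (localEquation φ₁ φ₂ m n₀)) g
    ?_ ?_ ?_
  · have hcard : (Set.range (localEquation (i := i) (k := k) (j := j) φ₁ φ₂ m n₀)).encard ≤
        (5 + m : ℕ) := by
      rw [← Set.image_univ]
      refine (Set.encard_image_le _ _).trans ?_
      rw [Set.encard_univ, ENat.card_eq_coe_fintype_card]
      simp only [Fintype.card_sum, Fintype.card_fin, Fintype.card_subtype_compl,
        Fintype.card_unique]
      exact_mod_cast (by omega : 3 + (3 - 1 + (m + 1 - 1)) ≤ 5 + m)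
    have h := h12.trans (add_le_add_right (WithBot.coe_le_coe.2 hcard) _)
    exact seven_le_add_of_twelve_le h
  · rintro _ ⟨l | l | n, rfl⟩
    · have := congrFun ht₀.1 l
      simpa [localEquation, Matrix.mulVec, dotProduct, fundamental, epipole₁, chartCoords] using this
    · have := congrFun ht₀.2 l.1
      simpa [localEquation, Matrix.vecMul, dotProduct, fundamental, epipole₂, chartCoords] using this
    · simp only [localEquation, map_sub, map_mul, eval_chartXi, eval_chartGamma, hc₀, eval_C]
      ring
  · simp only [g, map_mul, eval_chartGamma]
    refine mul_ne_zero hn₀ ?_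
    split_ifs with h
    · simp
    · rw [eval_chartXi, hc₀, map_mul, eval_C]
      exact mul_ne_zero (mul_ne_zero hr h) hn₀
  · intro x hx hgx
    simp only [Set.forall_mem_range] at hx
    simp only [g, map_mul, eval_chartGamma, mul_ne_zero_iff] at hgx
    have hFe : (fundamental (chartCoords x)).mulVec (epipole₁ (chartCoords x)) = 0 := by
      ext l
      have := hx (Sum.inl l)
      simpa [localEquation, Matrix.mulVec, dotProduct, fundamental, epipole₁, chartCoords] using this
    have heF : Matrix.vecMul (epipole₂ (chartCoords x)) (fundamental (chartCoords x)) = 0 := by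
      have hl : ∀ l, l ≠ i →
          Matrix.vecMul (epipole₂ (chartCoords x)) (fundamental (chartCoords x)) l = 0 := by
        intro l hl
        have := hx (Sum.inr (Sum.inl ⟨l, hl⟩))
        simpa [localEquation, Matrix.vecMul, dotProduct, fundamental, epipole₂, chartCoords]
          using this
      -- The omitted `i`-th coordinate of `e₂ᵀ F` equals `e₂ᵀ F e₁ = 0`, since `e₁` has `i`-th
      -- coordinate `1` and the other coordinates of `e₂ᵀ F` vanish.
      have hdot := Matrix.dotProduct_mulVec (epipole₂ (chartCoords x)) (fundamental (chartCoords x))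
        (epipole₁ (chartCoords x))
      rw [hFe, dotProduct_zero, dotProduct, Finset.sum_eq_single i
        (fun b _ hb => by rw [hl b hb, zero_mul]) (by simp), hone, mul_one] at hdot
      ext l
      by_cases h : l = i
      · rw [h, ← hdot]; rfl
      · exact hl l h
    have hepi : IsEpipolar (chart x) := (isCoords_chart x).isEpipolar_iff.2 ⟨hFe, heF⟩
    obtain ⟨r', hr', hrc'⟩ := (isCoords_chart x).exists_ne_zero hφ₁ hφ₂
    set ξ := compXi φ₂ (fundamental (chartCoords x)) with hξ
    set γ := compGamma φ₁ (epipole₁ (chartCoords x)) with hγ'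
    let c := eval (linePoint i n₀) ξ / eval (linePoint i n₀) γ
    refine hV _ hepi (c / r') (fun hc => ?_) ?_
    · rw [if_neg hc, eval_chartXi] at hgx
      exact div_ne_zero (div_ne_zero hgx.2 hgx.1) hr'
    · rw [hrc', mul_div_cancel₀ _ hr', ← sub_eq_zero]
      -- `ξ - c γ` vanishes at `n₀` by the choice of `c`, and at the other `m` points by the local
      -- equations.
      refine eq_zero_of_eval_linePoint ((isHomogeneous_compXi hφ₂ _).sub
        ((isHomogeneous_compGamma hφ₁ _).C_mul _)) (hone x) (fun p s => ?_) (fun n => ?_)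
      · simp only [map_sub, map_mul, eval_C, hξ, hγ', eval_compXi_add φ₂ hFe, eval_compGamma_add]
      · simp only [map_sub, map_mul, eval_C, c]
        by_cases hn : n = n₀
        · rw [hn, div_mul_cancel₀ _ hgx.1, sub_self]
        · have := hx (Sum.inr (Sum.inr ⟨n, hn⟩))
          simp only [localEquation, map_sub, map_mul, eval_chartXi, eval_chartGamma] at this
          have h0 := hgx.1
          rw [div_mul_eq_mul_div, sub_eq_zero, eq_div_iff h0]
          exact sub_eq_zero.1 this

end Equations

/-! ### The degenerate case of linear forms -/

/-- The linear form with coefficients `e`. -/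
noncomputable def linearForm (e : Fin 3 → ℂ) : MvPolynomial (Fin 3) ℂ := ∑ a, C (e a) * X a

theorem eval_linearForm (e p : Fin 3 → ℂ) : eval p (linearForm e) = dotProduct e p := by
  simp [linearForm, dotProduct]

theorem isHomogeneous_linearForm (e : Fin 3 → ℂ) : (linearForm e).IsHomogeneous 1 :=
  IsHomogeneous.sum _ _ _ fun _ _ => isHomogeneous_C_mul_X _ _

theorem exists_eq_linearForm {φ : MvPolynomial (Fin 3) ℂ} (h : φ.IsHomogeneous 1) :
    ∃ e, φ = linearForm e := by
  have h : φ ∈ homogeneousSubmodule (Fin 3) ℂ 1 := h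
  rw [homogeneousSubmodule_one_eq_span_X, Submodule.mem_span_range_iff_exists_fun] at h
  obtain ⟨e, rfl⟩ := h
  exact ⟨e, by simp [linearForm, smul_eq_C_mul]⟩

theorem exists_dotProduct_eq_one {e : Fin 3 → ℂ} (he : e ≠ 0) : ∃ w, dotProduct e w = 1 := by
  obtain ⟨i, hi⟩ := Function.ne_iff.1 he
  exact ⟨Pi.single i (e i)⁻¹, by simpa using mul_inv_cancel₀ hi⟩

theorem cross_cross_of_dotProduct {e u w : Fin 3 → ℂ} (hw : dotProduct e w = 1)
    (hu : dotProduct e u = 0) : crossProduct e (crossProduct u w) = u := by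
  rw [cross_cross_eq_smul_sub_smul', hw, dotProduct_comm, hu]
  simp

/-- Projecting along `w` onto the plane `e · u = 0` is a substitution congruent to the identity
modulo `linearForm e`, and it kills `φ`. -/
theorem linearForm_dvd {φ : MvPolynomial (Fin 3) ℂ} {e : Fin 3 → ℂ} (he : e ≠ 0)
    (h : ∀ u, dotProduct e u = 0 → eval u φ = 0) : linearForm e ∣ φ := by
  obtain ⟨w, hw⟩ := exists_dotProduct_eq_one he
  let s : Fin 3 → MvPolynomial (Fin 3) ℂ := fun a => X a - C (w a) * linearForm e
  have hs : bind₁ s φ = 0 := by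
    refine MvPolynomial.funext fun p => ?_
    rw [eval_bind₁, map_zero]
    refine h _ ?_
    have : (fun a => eval p (s a)) = p - dotProduct e p • w := by
      ext a
      simp [s, eval_linearForm, mul_comm]
    rw [this, dotProduct_sub, dotProduct_smul, hw]
    simp
  have hmod : (Ideal.Quotient.mkₐ ℂ (Ideal.span {linearForm e})).comp (bind₁ s) =
      Ideal.Quotient.mkₐ ℂ (Ideal.span {linearForm e}) := by
    ext a
    simp only [AlgHom.comp_apply, bind₁_X_right, Ideal.Quotient.mkₐ_eq_mk, Ideal.Quotient.eq, s]
    rw [sub_sub_cancel_left, neg_mem_iff, Ideal.mem_span_singleton]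
    exact Dvd.intro_left _ rfl
  have := DFunLike.congr_fun hmod φ
  rw [AlgHom.comp_apply, hs, map_zero, Ideal.Quotient.mkₐ_eq_mk, eq_comm,
    Ideal.Quotient.eq_zero_iff_mem, Ideal.mem_span_singleton] at this
  exact this

/-- An irreducible form that vanishes on a line is linear. -/
theorem degree_eq_one_of_compGamma_eq_zero {φ : MvPolynomial (Fin 3) ℂ} {m : ℕ}
    (hφ : φ.IsHomogeneous m) (hirr : Irreducible φ) {e : Fin 3 → ℂ} (he : e ≠ 0)
    (h : compGamma φ e = 0) : m = 1 := by
  obtain ⟨w, hw⟩ := exists_dotProduct_eq_one he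
  -- Every `u` orthogonal to `e` is a cross product `e × p`, so `φ` vanishes on that whole plane.
  obtain ⟨q, hq⟩ := linearForm_dvd (φ := φ) he fun u hu => by
    have := eval_compGamma φ e (crossProduct u w)
    rwa [h, map_zero, cross_cross_of_dotProduct hw hu, eq_comm] at this
  have hℓ : ¬ IsUnit (linearForm e) := fun hu => by
    have := hu.map (eval (0 : Fin 3 → ℂ))
    rw [eval_linearForm] at this
    simp at this
  have hqu : IsUnit q := (hirr.isUnit_or_isUnit hq).resolve_left hℓ
  have hq0 : q.totalDegree = 0 := by
    obtain ⟨q', hq'⟩ := hqu.exists_right_inv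
    have := totalDegree_mul_of_isDomain hqu.ne_zero (right_ne_zero_of_mul_eq_one hq')
    rw [hq', totalDegree_one] at this
    omega
  have hℓz : linearForm e ≠ 0 := fun h0 => hirr.ne_zero (by rw [hq, h0, zero_mul])
  rw [← hφ.totalDegree hirr.ne_zero, hq, totalDegree_mul_of_isDomain hℓz hqu.ne_zero, hq0,
    (isHomogeneous_linearForm e).totalDegree hℓz]

theorem exists_cross_ne_zero {l : Fin 3 → ℂ} (hl : l ≠ 0) : ∃ e, crossProduct l e ≠ 0 := by
  by_contra! h
  have h₀ := h (Pi.single 0 1)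
  have h₁ := h (Pi.single 1 1)
  refine hl ?_
  ext a
  have h₀₁ := congrFun h₀ 1
  have h₀₂ := congrFun h₀ 2
  have h₁₀ := congrFun h₁ 0
  simp [cross_apply] at h₀₁ h₀₂ h₁₀
  fin_cases a
  · have h₁₂ := congrFun h₁ 2
    simpa [cross_apply] using h₁₂
  · simpa using h₀₂
  · simpa using h₀₁

theorem exists_dotProduct_eq_zero (w : Fin 3 → ℂ) : ∃ e, e ≠ 0 ∧ dotProduct e w = 0 := by
  by_cases hw : w = 0
  · exact ⟨Pi.single 0 1, by simp, by simp [hw]⟩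
  · obtain ⟨e, he⟩ := exists_cross_ne_zero hw
    exact ⟨_, he, by rw [dotProduct_comm, dot_self_cross]⟩

/-- For linear forms the Kruppa equation has solutions in which neither side is zero. -/
theorem exists_solution_of_isHomogeneous_one {φ₁ φ₂ : MvPolynomial (Fin 3) ℂ}
    (h₁ : φ₁.IsHomogeneous 1) (h₂ : φ₂.IsHomogeneous 1) (hz₁ : φ₁ ≠ 0) (hz₂ : φ₂ ≠ 0) :
    ∃ t : Triple, IsEpipolar t ∧ compGamma φ₁ t.e₁.coords ≠ 0 ∧
      ∃ c : ℂ, c ≠ 0 ∧ compXi φ₂ t.F.matrix = C c * compGamma φ₁ t.e₁.coords := by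
  obtain ⟨l₁, hl₁⟩ := exists_eq_linearForm h₁
  obtain ⟨l₂, hl₂⟩ := exists_eq_linearForm h₂
  have hlz₁ : l₁ ≠ 0 := fun h => hz₁ (by simp [hl₁, h, linearForm])
  have hlz₂ : l₂ ≠ 0 := fun h => hz₂ (by simp [hl₂, h, linearForm])
  obtain ⟨e, hu⟩ := exists_cross_ne_zero hlz₁
  set u := crossProduct l₁ e with hu'
  have he : e ≠ 0 := fun h => hu (by rw [hu', h, map_zero])
  obtain ⟨w, hw⟩ := exists_dotProduct_eq_one hlz₂
  have hw0 : w ≠ 0 := fun h => by simp [h] at hw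
  obtain ⟨e', he', hew⟩ := exists_dotProduct_eq_zero w
  obtain ⟨p, hp⟩ := exists_dotProduct_eq_one hu
  -- With `F = w uᵀ`, `u = l₁ × e` and `l₂ · w = 1`, both `φ₂(F p)` and `φ₁(e × p)` equal `u · p`;
  -- moreover `u · e = 0` and `e' · w = 0`.
  let v : TripleVar → ℂ := Sum.elim e (Sum.elim (fun a => w a.1 * u a.2) e')
  have hF : fundamental v = Matrix.vecMulVec w u := rfl
  have hF0 : (fun a : Fin 3 × Fin 3 => w a.1 * u a.2) ≠ 0 := by
    obtain ⟨a, ha⟩ := Function.ne_iff.1 hw0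
    obtain ⟨b, hb⟩ := Function.ne_iff.1 hu
    exact Function.ne_iff.2 ⟨(a, b), mul_ne_zero ha hb⟩
  let t : Triple := ⟨PSpace.mk e he, PSpace.mk _ hF0, PSpace.mk e' he'⟩
  have ht : IsCoords t v := by
    obtain ⟨c₁, h₁, e₁⟩ := PSpace.exists_coords_mk e he
    obtain ⟨c₂, h₂, e₂⟩ := PSpace.exists_coords_mk _ hF0
    obtain ⟨c₃, h₃, e₃⟩ := PSpace.exists_coords_mk e' he'
    exact ⟨c₁, c₂, c₃, h₁, h₂, h₃, e₁, e₂, e₃⟩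
  have hγ : ∀ p, eval p (compGamma φ₁ e) = dotProduct u p := fun p => by
    rw [eval_compGamma, hl₁, eval_linearForm, triple_product_permutation,
      triple_product_permutation, dotProduct_comm]
  obtain ⟨r, hr, hrc⟩ := ht.exists_ne_zero h₁ h₂
  refine ⟨t, ht.isEpipolar_iff.2 ⟨?_, ?_⟩, ?_, r⁻¹, inv_ne_zero hr, ?_⟩
  · rw [hF, Matrix.vecMulVec_mulVec]
    rw [show dotProduct u (epipole₁ v) = 0 by
      rw [dotProduct_comm]; exact dot_cross_self l₁ e]
    simp
  · rw [hF, Matrix.vecMul_vecMulVec, show dotProduct (epipole₂ v) w = 0 from hew, zero_smul]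
  · rw [Ne, ht.compGamma_eq_zero_iff h₁]
    intro h
    have := hγ p
    rw [show compGamma φ₁ e = 0 from h, hp] at this
    simp at this
  · rw [hrc, mul_inv_cancel₀ hr, C_1, one_mul]
    refine MvPolynomial.funext fun p => ?_
    rw [show epipole₁ v = e from rfl, hγ, eval_compXi, hF, hl₂, eval_linearForm,
      Matrix.vecMulVec_mulVec, dotProduct_smul, hw]
    simp

/-! ### Elimination of the scalar and conclusion -/

theorem KruppaEquations.exists_eq_C_mul {φ₁ φ₂ : MvPolynomial (Fin 3) ℂ} {t : Triple}
    (h : KruppaEquations φ₁ φ₂ t) (hγ : compGamma φ₁ t.e₁.coords ≠ 0) :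
    ∃ c : ℂ, compXi φ₂ t.F.matrix = C c * compGamma φ₁ t.e₁.coords := by
  obtain ⟨β, hβ⟩ := ne_zero_iff.1 hγ
  refine ⟨coeff β (compXi φ₂ t.F.matrix) / coeff β (compGamma φ₁ t.e₁.coords), ?_⟩
  ext α
  rw [coeff_C_mul, div_mul_eq_mul_div, eq_div_iff hβ]
  exact h α β

theorem kruppaEquations_of_eq_C_mul {φ₁ φ₂ : MvPolynomial (Fin 3) ℂ} {t : Triple} {c : ℂ}
    (h : compXi φ₂ t.F.matrix = C c * compGamma φ₁ t.e₁.coords) : KruppaEquations φ₁ φ₂ t := by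
  intro α β
  rw [h, coeff_C_mul, coeff_C_mul]
  ring

end Kruppa

theorem mainTheorem7
    (X : Set Kruppa.P3) (hX : Kruppa.IsSpaceCurve X)
    (M₁ M₂ : Matrix (Fin 3) (Fin 4) ℂ) (hM₁ : M₁.rank = 3) (hM₂ : M₂.rank = 3)
    (hO₁ : ∀ P ∈ X, M₁.mulVec P.coords ≠ 0) (hO₂ : ∀ P ∈ X, M₂.mulVec P.coords ≠ 0)
    (f₁ f₂ φ₁ φ₂ : MvPolynomial (Fin 3) ℂ) (d₁ d₂ m : ℕ)
    (hf₁ : Kruppa.IsEquation f₁ d₁ (Kruppa.projection M₁ X))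
    (hf₂ : Kruppa.IsEquation f₂ d₂ (Kruppa.projection M₂ X))
    (hφ₁ : Kruppa.IsEquation φ₁ m (Kruppa.dualCurve f₁))
    (hφ₂ : Kruppa.IsEquation φ₂ m (Kruppa.dualCurve f₂)) :
    ((Kruppa.kruppaVariety φ₁ φ₂).Nonempty →
      (7 : WithBot ℕ∞) ≤ topologicalKrullDim (Kruppa.kruppaVariety φ₁ φ₂) + (m : WithBot ℕ∞)) ∧
    ((Kruppa.kruppaSolutions φ₁ φ₂).Nonempty →
      (7 : WithBot ℕ∞) ≤
        topologicalKrullDim (Kruppa.kruppaSolutions φ₁ φ₂) + (m : WithBot ℕ∞)) := by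
  open Kruppa in
  obtain ⟨hφ₁, hirr₁, -⟩ := hφ₁
  obtain ⟨hφ₂, hirr₂, -⟩ := hφ₂
  -- A solution without a pivot is replaced by another one; a local bound at any point of the set
  -- suffices. Its scalar is nonzero, so it serves both claims.
  have hlinear : ∀ t : Triple, compGamma φ₁ t.e₁.coords = 0 →
      ∃ t : Triple, IsEpipolar t ∧ compGamma φ₁ t.e₁.coords ≠ 0 ∧
        ∃ c : ℂ, c ≠ 0 ∧ compXi φ₂ t.F.matrix = C c * compGamma φ₁ t.e₁.coords := by
    intro t ht
    obtain rfl := degree_eq_one_of_compGamma_eq_zero hφ₁ hirr₁ t.e₁.coords_ne_zero ht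
    exact exists_solution_of_isHomogeneous_one hφ₁ hφ₂ hirr₁.ne_zero hirr₂.ne_zero
  constructor
  · rintro ⟨t, htK, htE⟩
    obtain ⟨t, htE, hγ, c, hc⟩ : ∃ t : Triple, IsEpipolar t ∧ compGamma φ₁ t.e₁.coords ≠ 0 ∧
        ∃ c : ℂ, compXi φ₂ t.F.matrix = C c * compGamma φ₁ t.e₁.coords := by
      by_cases hγ : compGamma φ₁ t.e₁.coords = 0
      · obtain ⟨t, h₁, h₂, c, -, h₃⟩ := hlinear t hγ
        exact ⟨t, h₁, h₂, c, h₃⟩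
      · exact ⟨t, htE, hγ, htK.exists_eq_C_mul hγ⟩
    exact seven_le_topologicalKrullDim_add hφ₁ hφ₂ _ t c htE hγ hc fun t' ht' c' _ hc' =>
      ⟨kruppaEquations_of_eq_C_mul hc', ht'⟩
  · rintro ⟨t, htK, htE⟩
    obtain ⟨t, htE, hγ, c, hc0, hc⟩ : ∃ t : Triple, IsEpipolar t ∧
        compGamma φ₁ t.e₁.coords ≠ 0 ∧
        ∃ c : ℂ, c ≠ 0 ∧ compXi φ₂ t.F.matrix = C c * compGamma φ₁ t.e₁.coords := by
      by_cases hγ : compGamma φ₁ t.e₁.coords = 0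
      · exact hlinear t hγ
      · exact ⟨t, htE, hγ, htK⟩
    exact seven_le_topologicalKrullDim_add hφ₁ hφ₂ _ t c htE hγ hc fun t' ht' c' hcz hc' =>
      ⟨⟨c', hcz hc0, hc'⟩, ht'⟩
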